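/- Let $A$ be a pro-$C^*$-algebra, i.e. a complete Hausdorff complex topological $*$-algebra (not necessarily unital) whose topology is given by the set $S(A)$ of its continuous $C^*$-seminorms, and let $E$ be a Hilbert $A$-module: a complex vector space and compatible right $A$-module with a positive definite $A$-valued inner product $\langle\cdot,\cdot\rangle$, $A$-linear in the second variable, complete for the seminorms $\xi\mapsto\sqrt{p(\langle \xi,\xi\rangle)}$, $p\in S(A)$. Regard $A$ as a Hilbert $A$-module with $\langle a,b\rangle=a^*b$, let $H_A$ be the module of all sequences $(a_n)_n$ in $A$ such that $\sum_n a_n^*a_n$ converges, with $\langle (a_n),(b_n)\rangle=\sum_n a_n^*b_n$, let $L(E,F)$ be the set of adjointable module morphisms $E\to F$, $L(E)=L(E,E)$, and let $M(E)=L(A,E)$ be the multiplier module. For $h\in M(E)$ and $\xi\in E$ put $\langle h,\xi\rangle=h^*(\xi)\in A$, $\langle\xi,h\rangle=\langle h,\xi\rangle^*$. Assume that $E$ is countably generated in $M(E)$: there are $g_1,g_2,\dots\in M(E)$ such that the closed submodule generated by $\{g_n(a): a\in A,\ n\ge1\}$ is $E$. A sequence $\{h_n\}$ in $M(E)$ is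 a standard frame of multipliers in $E$ if for every $\xi\in E$ the series $\sum_n\langle\xi,h_n\rangle\langle h_n,\xi\rangle$ converges in $A$ and there are constants $C,D>0$ with $C\langle\xi,\xi\rangle\le\sum_n\langle\xi,h_n\rangle\langle h_n,\xi\rangle\le D\langle\xi,\xi\rangle$ for all $\xi\in E$. Its frame transform is the map $\theta:E\to H_A$, $\theta(\xi)=(\langle h_n,\xi\rangle)_n$, and, when $\theta$ is adjointable and $\theta^*\theta$ is invertible in $L(E)$, its canonical dual is the sequence $\{(\theta^*\theta)^{-1}\circ h_n\}_n$ in $M(E)$. A standard frame of multipliers $\{t_n\}$ is a dual frame of $\{h_n\}$ if $\xi=\sum_n h_n(\langle t_n,\xi\rangle)$ (convergent in $E$) for all $\xi\in E$. Let $\{h_n\}$ be a standard frame of multipliers in $E$. Then its canonical dual $t_n=(\theta^*\theta)^{-1}\circ h_n$ is well defined, $\{t_n\}$ is a standard frame of multipliers in $E$ and a dual frame of $\{h_n\}$, the canonical dual of $\{t_n\}$ is well defined, and it is $\{h_n\}$ itself: if $\theta'$ is the frame transform of $\{t_n\}$, then $(\theta'^*\theta')^{-1}\circ t_n=h_n$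 for all $n$. -/

import Mathlib

open Filter Topology Uniformity

namespace ProCStar

/-- `p` is a C*-seminorm: a submultiplicative seminorm with `p (a* a) = p (a) ^ 2`. -/
structure IsCStarSeminorm {A : Type*} [NonUnitalRing A] [StarRing A] [Module ℂ A]
    (p : Seminorm ℂ A) : Prop where
  mul_le : ∀ a b : A, p (a * b) ≤ p a * p b
  star_mul_self : ∀ a : A, p (star a * a) = p a ^ 2

/-- The set `S(A)` of all continuous C*-seminorms on `A`. -/
abbrev ContSeminorm (A : Type*) [NonUnitalRing A] [StarRing A] [Module ℂ A] [TopologicalSpace A] :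
    Type _ :=
  {p : Seminorm ℂ A // IsCStarSeminorm p ∧ Continuous p}

/-- Pro-C*-algebras: complete Hausdorff topological *-algebras over `ℂ` (not necessarily unital)
whose topology is given by their continuous C*-seminorms. -/
class ProCStarAlgebra (A : Type*) extends NonUnitalRing A, StarRing A, Module ℂ A,
    IsScalarTower ℂ A A, SMulCommClass ℂ A A, StarModule ℂ A, UniformSpace A,
    IsUniformAddGroup A, ContinuousMul A, ContinuousStar A, ContinuousSMul ℂ A,
    CompleteSpace A, T2Space A where
  withSeminorms : WithSeminorms (fun p : ContSeminorm A => (p.1 : Seminorm ℂ A))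

section Completion

variable {A : Type*} [NonUnitalRing A] [StarRing A] [Module ℂ A]

lemma IsCStarSeminorm.map_star {p : Seminorm ℂ A} (hp : IsCStarSeminorm p) (a : A) :
    p (star a) = p a := by
  have key : ∀ b : A, p b ≤ p (star b) := fun b => by
    by_cases h0 : p b = 0
    · rw [h0]; exact apply_nonneg p _
    · have hpos : 0 < p b := lt_of_le_of_ne (apply_nonneg p b) (Ne.symm h0)
      have := hp.mul_le (star b) b
      rw [hp.star_mul_self] at this
      nlinarith
  refine le_antisymm ?_ (key a)
  have := key (star a)
  rwa [star_star] at this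

end Completion

open UniformSpace in
/-- The completion of `A` with respect to a C*-seminorm is a C*-algebra. -/
theorem exists_rep.{u} {A : Type u} [NonUnitalRing A] [StarRing A] [Module ℂ A]
    [IsScalarTower ℂ A A] [SMulCommClass ℂ A A] [StarModule ℂ A]
    {p : Seminorm ℂ A} (hp : IsCStarSeminorm p) :
    ∃ (B : Type u) (_ : NonUnitalCStarAlgebra B) (f : A →⋆ₙₐ[ℂ] B), ∀ a, ‖f a‖ = p a := by
  let iN : NonUnitalSeminormedRing A :=
    { p.toSeminormedAddCommGroup, (inferInstance : NonUnitalRing A) with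
      norm_mul_le := hp.mul_le }
  have hnorm : ∀ a : A, ‖a‖ = p a := fun a => rfl
  let iS : NormedSpace ℂ A := { norm_smul_le := fun c a => (map_smul_eq_mul p c a).le }
  let di : IsDenseInducing (Completion.toCompl : A →+ Completion A) := Completion.isDenseInducing_coe
  let iM : Mul (Completion A) := ⟨Function.curry <|
    (di.prodMap di).extend ((↑) ∘ Function.uncurry (· * ·))⟩
  have coe_mul : ∀ a b : A, ((a * b : A) : Completion A) = a * b := fun a b =>
    ((di.prodMap di).extend_eq
      ((Completion.continuous_coe A).comp (@continuous_mul A _ _ _)) (a, b)).symm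
  have iCM : ContinuousMul (Completion A) := ⟨by
    let m := (AddMonoidHom.mul : A →+ A →+ A).compr₂ Completion.toCompl
    have : Continuous fun q : A × A => m q.1 q.2 := (Completion.continuous_coe A).comp continuous_mul
    exact (di.extend_Z_bilin di this :)⟩
  have huc : UniformContinuous (star : A → A) := by
    refine Isometry.uniformContinuous (Isometry.of_dist_eq fun a b => ?_)
    rw [dist_eq_norm, dist_eq_norm, ← star_sub, hnorm, hnorm, hp.map_star]
  let iSt : Star (Completion A) := ⟨Completion.map star⟩
  have coe_star : ∀ a : A, ((star a : A) : Completion A) = star (a : Completion A) := fun a =>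
    (Completion.map_coe huc a).symm
  have iCS : Continuous (star : Completion A → Completion A) := Completion.continuous_map
  let iR : NonUnitalRing (Completion A) :=
    { (inferInstance : AddCommGroup (Completion A)), iM with
      zero_mul a := Completion.induction_on a (isClosed_eq (by fun_prop) continuous_const)
        fun a => by rw [← Completion.coe_zero, ← coe_mul, zero_mul]
      mul_zero a := Completion.induction_on a (isClosed_eq (by fun_prop) continuous_const)
        fun a => by rw [← Completion.coe_zero, ← coe_mul, mul_zero]
      mul_assoc a b c := Completion.induction_on₃ a b c
        (isClosed_eq (by fun_prop) (by fun_prop))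
        fun a b c => by rw [← coe_mul, ← coe_mul, ← coe_mul, ← coe_mul, mul_assoc]
      left_distrib a b c := Completion.induction_on₃ a b c
        (isClosed_eq (by fun_prop) (by fun_prop))
        fun a b c => by
          rw [← Completion.coe_add, ← coe_mul, ← coe_mul, ← coe_mul, ← Completion.coe_add, mul_add]
      right_distrib a b c := Completion.induction_on₃ a b c
        (isClosed_eq (by fun_prop) (by fun_prop))
        fun a b c => by
          rw [← Completion.coe_add, ← coe_mul, ← coe_mul, ← coe_mul, ← Completion.coe_add, add_mul] }
  let iSR : StarRing (Completion A) :=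
    { iSt with
      star_involutive a := Completion.induction_on a (isClosed_eq (by fun_prop) continuous_id)
        fun a => by rw [← coe_star, ← coe_star, star_star]
      star_mul a b := Completion.induction_on₂ a b
        (isClosed_eq (by fun_prop) (by fun_prop))
        fun a b => by rw [← coe_star, ← coe_star, ← coe_mul, ← coe_mul, ← coe_star, star_mul]
      star_add a b := Completion.induction_on₂ a b
        (isClosed_eq (by fun_prop) (by fun_prop))
        fun a b => by
          rw [← coe_star, ← coe_star, ← Completion.coe_add, ← Completion.coe_add, ← coe_star,
            star_add] }
  let iNR : NonUnitalNormedRing (Completion A) :=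
    { (inferInstance : NormedAddCommGroup (Completion A)), iR with
      norm_mul_le a b := Completion.induction_on₂ a b
        (isClosed_le (by fun_prop) (by fun_prop))
        fun a b => by
          rw [← coe_mul, Completion.norm_coe, Completion.norm_coe, Completion.norm_coe]
          exact hp.mul_le a b }
  have iCR : CStarRing (Completion A) := ⟨fun a => Completion.induction_on a
    (isClosed_le (by fun_prop) (by fun_prop))
    fun a => by
      rw [← coe_star, ← coe_mul, Completion.norm_coe, Completion.norm_coe, hnorm, hnorm,
        hp.star_mul_self, pow_two]⟩
  have smul_mul : ∀ (c : ℂ) (a b : Completion A), (c • a) * b = c • (a * b) := fun c a b =>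
    Completion.induction_on₂ a b (isClosed_eq
      (((continuous_const_smul c).comp continuous_fst).mul continuous_snd)
      ((continuous_const_smul c).comp (continuous_fst.mul continuous_snd)))
      fun a b => by
        rw [← Completion.coe_smul, ← coe_mul, ← coe_mul, ← Completion.coe_smul, smul_mul_assoc]
  have mul_smul' : ∀ (c : ℂ) (a b : Completion A), a * (c • b) = c • (a * b) := fun c a b =>
    Completion.induction_on₂ a b (isClosed_eq
      (continuous_fst.mul ((continuous_const_smul c).comp continuous_snd))
      ((continuous_const_smul c).comp (continuous_fst.mul continuous_snd)))
      fun a b => by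
        rw [← Completion.coe_smul, ← coe_mul, ← coe_mul, ← Completion.coe_smul, mul_smul_comm]
  have iT : IsScalarTower ℂ (Completion A) (Completion A) := ⟨smul_mul⟩
  have iC : SMulCommClass ℂ (Completion A) (Completion A) :=
    ⟨fun c a b => (mul_smul' c a b).symm⟩
  have iSM : StarModule ℂ (Completion A) := ⟨fun c a => Completion.induction_on a
    (isClosed_eq (iCS.comp (continuous_const_smul c)) ((continuous_const_smul (star c)).comp iCS))
    fun a => by
      rw [← Completion.coe_smul, ← coe_star, ← coe_star, ← Completion.coe_smul, star_smul]⟩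
  let iB : NonUnitalCStarAlgebra (Completion A) :=
    { iNR, iSR, iCR, iT, iC, iSM, (inferInstance : NormedSpace ℂ (Completion A)),
      (inferInstance : CompleteSpace (Completion A)) with }
  exact ⟨Completion A, iB,
    { toFun := fun a => (a : Completion A)
      map_smul' := fun c a => Completion.coe_smul c a
      map_zero' := Completion.coe_zero
      map_add' := Completion.coe_add
      map_mul' := coe_mul
      map_star' := coe_star }, fun a => Completion.norm_coe a⟩

/-- The Cauchy-Schwarz inequality for finite families, with respect to a C*-seminorm. -/
lemma seminorm_sum_star_mul_le {A : Type*} [NonUnitalRing A] [StarRing A] [Module ℂ A]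
    [IsScalarTower ℂ A A] [SMulCommClass ℂ A A] [StarModule ℂ A]
    {p : Seminorm ℂ A} (hp : IsCStarSeminorm p) (s : Finset ℕ) (a b : ℕ → A) :
    p (∑ k ∈ s, star (a k) * b k) ≤
      √(p (∑ k ∈ s, star (a k) * a k)) * √(p (∑ k ∈ s, star (b k) * b k)) := by
  obtain ⟨B, iB, f, hf⟩ := exists_rep hp
  let iO : PartialOrder B := CStarAlgebra.spectralOrder B
  have iSO : StarOrderedRing B := CStarAlgebra.spectralOrderedRing B
  have key : ∀ c d : ℕ → A, inner B
      ((WithCStarModule.equiv B (s → B)).symm fun k => f (star (c k)))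
      ((WithCStarModule.equiv B (s → B)).symm fun k => f (star (d k)))
      = f (∑ k ∈ s, star (d k) * c k) := fun c d => by
    rw [WithCStarModule.pi_inner, map_sum, ← Finset.sum_coe_sort s]
    refine Finset.sum_congr rfl fun k _ => ?_
    simp [WithCStarModule.inner_def, map_star, map_mul]
  have hn : ∀ c : ℕ → A, ‖(WithCStarModule.equiv B (s → B)).symm fun k => f (star (c k))‖
      = √(p (∑ k ∈ s, star (c k) * c k)) := fun c => by
    rw [CStarModule.norm_eq_sqrt_norm_inner_self (A := B)
      ((WithCStarModule.equiv B (s → B)).symm fun k => f (star (c k))), key, hf]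
  have := CStarModule.norm_inner_le (A := B) (WithCStarModule B (s → B))
    (x := (WithCStarModule.equiv B (s → B)).symm fun k => f (star (b k)))
    (y := (WithCStarModule.equiv B (s → B)).symm fun k => f (star (a k)))
  rw [hn, hn, key, hf] at this
  rwa [mul_comm]

/-! ### Hilbert modules -/

/-- Complex vector spaces with a right action of `A` (written `MulOpposite.op a • x` for `x a`) and
an `A`-valued map `inner A`, linear in the second variable, satisfying the algebraic laws of a
right module with Hermitian inner product. -/
class IsInnerModule (A E : Type*) [ProCStarAlgebra A] [AddCommGroup E] [Module ℂ E]
    [SMul Aᵐᵒᵖ E] [Inner A E] : Prop where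
  add_rsmul : ∀ (x y : E) (a : A), MulOpposite.op a • (x + y) =
    MulOpposite.op a • x + MulOpposite.op a • y
  rsmul_add : ∀ (x : E) (a b : A), MulOpposite.op (a + b) • x =
    MulOpposite.op a • x + MulOpposite.op b • x
  rsmul_mul : ∀ (x : E) (a b : A), MulOpposite.op (a * b) • x =
    MulOpposite.op b • (MulOpposite.op a • x)
  smul_rsmul : ∀ (c : ℂ) (x : E) (a : A), MulOpposite.op a • (c • x) =
    c • (MulOpposite.op a • x)
  rsmul_smul : ∀ (c : ℂ) (x : E) (a : A), MulOpposite.op (c • a) • x =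
    c • (MulOpposite.op a • x)
  inner_add : ∀ x y z : E, inner A x (y + z) = inner A x y + inner A x z
  inner_smul : ∀ (c : ℂ) (x y : E), inner A x (c • y) = c • inner A x y
  inner_rsmul : ∀ (x y : E) (a : A), inner A x (MulOpposite.op a • y) = inner A x y * a
  star_inner : ∀ x y : E, star (inner A x y) = inner A y x

/-- The seminorm `x ↦ √(p ⟨x, x⟩)` on a module with `A`-valued inner product. -/
noncomputable def moduleSeminorm {A E : Type*} [ProCStarAlgebra A] [Inner A E]
    (p : ContSeminorm A) (x : E) : ℝ :=
  √(p.1 (inner A x x))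

/-- Hilbert `A`-modules: the inner product is positive definite, the uniform structure of `E` is the
one given by the seminorms `moduleSeminorm p`, `p ∈ S(A)`, and `E` is complete for it. -/
class IsHilbertModule (A E : Type*) [ProCStarAlgebra A] [PartialOrder A] [StarOrderedRing A]
    [AddCommGroup E] [Module ℂ E] [SMul Aᵐᵒᵖ E] [Inner A E] [UniformSpace E] : Prop
    extends IsInnerModule A E where
  inner_self_nonneg : ∀ x : E, 0 ≤ inner A x x
  inner_self_eq_zero : ∀ x : E, inner A x x = 0 ↔ x = 0
  uniformity_eq : 𝓤 E = ⨅ p : ContSeminorm A,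
    (𝓝 (0 : ℝ)).comap fun z : E × E => moduleSeminorm p (z.1 - z.2)
  complete : CompleteSpace E

/-! ### Adjointable module morphisms -/

/-- The set `L(E, F)` of adjointable module morphisms, each recorded together with its adjoint
(which is uniquely determined when the inner product of `E` is definite). -/
@[ext]
structure Adjointable (A E F : Type*) [ProCStarAlgebra A]
    [AddCommGroup E] [Module ℂ E] [SMul Aᵐᵒᵖ E] [Inner A E]
    [AddCommGroup F] [Module ℂ F] [SMul Aᵐᵒᵖ F] [Inner A F] where
  toFun : E →ₗ[ℂ] F
  adj : F →ₗ[ℂ] E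
  map_rsmul : ∀ (x : E) (a : A), toFun (MulOpposite.op a • x) = MulOpposite.op a • toFun x
  adj_rsmul : ∀ (y : F) (a : A), adj (MulOpposite.op a • y) = MulOpposite.op a • adj y
  inner_toFun : ∀ (x : E) (y : F), inner A (toFun x) y = inner A x (adj y)

namespace Adjointable

variable {A E F G : Type*} [ProCStarAlgebra A]
  [AddCommGroup E] [Module ℂ E] [SMul Aᵐᵒᵖ E] [Inner A E]
  [AddCommGroup F] [Module ℂ F] [SMul Aᵐᵒᵖ F] [Inner A F]
  [AddCommGroup G] [Module ℂ G] [SMul Aᵐᵒᵖ G] [Inner A G]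

/-- The identity of `E`. -/
def id (A E : Type*) [ProCStarAlgebra A] [AddCommGroup E] [Module ℂ E] [SMul Aᵐᵒᵖ E]
    [Inner A E] : Adjointable A E E where
  toFun := LinearMap.id
  adj := LinearMap.id
  map_rsmul _ _ := rfl
  adj_rsmul _ _ := rfl
  inner_toFun _ _ := rfl

/-- The composition `S ∘ T`. -/
def comp (S : Adjointable A F G) (T : Adjointable A E F) : Adjointable A E G where
  toFun := S.toFun ∘ₗ T.toFun
  adj := T.adj ∘ₗ S.adj
  map_rsmul x a := by simp [T.map_rsmul, S.map_rsmul]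
  adj_rsmul y a := by simp [T.adj_rsmul, S.adj_rsmul]
  inner_toFun x y := by simp [T.inner_toFun, S.inner_toFun]

/-- The adjoint `T*`. -/
def adjoint [IsInnerModule A E] [IsInnerModule A F] (T : Adjointable A E F) :
    Adjointable A F E where
  toFun := T.adj
  adj := T.toFun
  map_rsmul := T.adj_rsmul
  adj_rsmul := T.map_rsmul
  inner_toFun y x := by
    rw [← IsInnerModule.star_inner, ← T.inner_toFun, IsInnerModule.star_inner]

end Adjointable

/-! ### The modules `A` and `H_A` -/

/-- The inner product `⟨a, b⟩ = a* b` of `A` as a module over itself; the right action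
`MulOpposite.op b • a = a * b` is Mathlib's. -/
instance instInnerSelf (A : Type*) [ProCStarAlgebra A] : Inner A A where
  inner a b := star a * b

/-- The algebra `A` as a module over itself. -/
instance instIsInnerModuleSelf (A : Type*) [ProCStarAlgebra A] : IsInnerModule A A where
  add_rsmul x y a := add_mul x y a
  rsmul_add x a b := mul_add x a b
  rsmul_mul x a b := (mul_assoc x a b).symm
  smul_rsmul c x a := smul_mul_assoc c x a
  rsmul_smul c x a := mul_smul_comm c x a
  inner_add x y z := mul_add (star x) y z
  inner_smul c x y := mul_smul_comm c (star x) y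
  inner_rsmul x y a := (mul_assoc (star x) y a).symm
  star_inner x y := by simp [inner]

/-- The series `∑ₙ f n` converges to `s`, i.e. its sequence of partial sums does. -/
def SeriesTendsto {X : Type*} [AddCommMonoid X] [TopologicalSpace X] (f : ℕ → X) (s : X) : Prop :=
  Tendsto (fun N => ∑ n ∈ Finset.range N, f n) atTop (𝓝 s)

section StdModule

variable {A : Type*} [ProCStarAlgebra A]

/-- In a pro-C*-algebra a series converges iff it is Cauchy for every continuous C*-seminorm. -/
lemma exists_seriesTendsto_iff (f : ℕ → A) : (∃ s, SeriesTendsto f s) ↔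
    ∀ p : ContSeminorm A, ∀ ε > 0, ∃ N, ∀ m n, N ≤ m → m ≤ n →
      p.1 (∑ k ∈ Finset.Ico m n, f k) < ε := by
  have h1 : (∃ s, SeriesTendsto f s) ↔
      CauchySeq (fun N => ∑ n ∈ Finset.range N, f n) :=
    ⟨fun ⟨s, hs⟩ => Tendsto.cauchySeq hs, fun h => cauchySeq_tendsto_of_complete h⟩
  have : Nonempty (ContSeminorm A) :=
    ⟨⟨0, ⟨fun _ _ => by simp, fun _ => by simp⟩, continuous_const⟩⟩
  rw [h1, CauchySeq, IsUniformAddGroup.cauchy_map_iff_tendsto, and_iff_right atTop_neBot,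
    ProCStarAlgebra.withSeminorms.tendsto_nhds]
  have hsum : ∀ m n, m ≤ n → ∑ k ∈ Finset.range n, f k - ∑ k ∈ Finset.range m, f k =
      ∑ k ∈ Finset.Ico m n, f k := fun m n hmn => (Finset.sum_Ico_eq_sub f hmn).symm
  refine forall_congr' fun p => forall₂_congr fun ε hε => ?_
  simp only [sub_zero]
  rw [prod_atTop_atTop_eq]
  constructor
  · intro h
    obtain ⟨⟨N, M⟩, hN⟩ := eventually_atTop.mp h
    refine ⟨max N M, fun m n hm hmn => ?_⟩
    rw [← hsum m n hmn]
    exact hN (n, m) ⟨le_trans (le_max_left _ _) (hm.trans hmn), le_trans (le_max_right _ _) hm⟩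
  · rintro ⟨N, hN⟩
    refine eventually_atTop.mpr ⟨(N, N), fun ⟨n, m⟩ ⟨hn, hm⟩ => ?_⟩
    change p.1 (∑ k ∈ Finset.range n, f k - ∑ k ∈ Finset.range m, f k) < ε
    rcases le_total m n with h | h
    · rw [hsum m n h]; exact hN m n hm h
    · rw [map_sub_rev, hsum n m h]; exact hN n m hn h

/-- Cauchy-Schwarz: if `∑ a_n* a_n` and `∑ b_n* b_n` converge then so does `∑ a_n* b_n`. -/
lemma exists_inner_series {a b : ℕ → A} (ha : ∃ s, SeriesTendsto (fun n => star (a n) * a n) s)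
    (hb : ∃ s, SeriesTendsto (fun n => star (b n) * b n) s) :
    ∃ s, SeriesTendsto (fun n => star (a n) * b n) s := by
  rw [exists_seriesTendsto_iff] at *
  intro p ε hε
  obtain ⟨N, hN⟩ := ha p ε hε
  obtain ⟨M, hM⟩ := hb p ε hε
  refine ⟨max N M, fun m n hm hmn => ?_⟩
  have h1 := hN m n (le_trans (le_max_left _ _) hm) hmn
  have h2 := hM m n (le_trans (le_max_right _ _) hm) hmn
  refine (seminorm_sum_star_mul_le p.2.1 _ a b).trans_lt ?_
  rw [← Real.mul_self_sqrt hε.le]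
  have h3 := Real.sqrt_lt_sqrt (apply_nonneg _ _) h1
  have h4 := Real.sqrt_lt_sqrt (apply_nonneg _ _) h2
  exact mul_lt_mul'' h3 h4 (Real.sqrt_nonneg _) (Real.sqrt_nonneg _)

lemma SeriesTendsto.add {f g : ℕ → A} {s t : A} (hf : SeriesTendsto f s)
    (hg : SeriesTendsto g t) : SeriesTendsto (fun n => f n + g n) (s + t) := by
  simpa only [SeriesTendsto, Finset.sum_add_distrib] using Tendsto.add hf hg

lemma SeriesTendsto.map {f : ℕ → A} {s : A} (hf : SeriesTendsto f s) (φ : A →+ A)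
    (hφ : Continuous φ) : SeriesTendsto (fun n => φ (f n)) (φ s) := by
  simpa only [SeriesTendsto, Function.comp_def, map_sum] using (hφ.tendsto s).comp hf

lemma SeriesTendsto.const_smul {f : ℕ → A} {s : A} (hf : SeriesTendsto f s) (c : ℂ) :
    SeriesTendsto (fun n => c • f n) (c • s) :=
  hf.map (DistribSMul.toAddMonoidHom A c) (continuous_const_smul c)

lemma SeriesTendsto.mul_const {f : ℕ → A} {s : A} (hf : SeriesTendsto f s) (a : A) :
    SeriesTendsto (fun n => f n * a) (s * a) :=
  hf.map (AddMonoidHom.mulRight a) (continuous_mul_const a)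

lemma SeriesTendsto.const_mul {f : ℕ → A} {s : A} (hf : SeriesTendsto f s) (a : A) :
    SeriesTendsto (fun n => a * f n) (a * s) :=
  hf.map (AddMonoidHom.mulLeft a) (continuous_const_mul a)

lemma SeriesTendsto.star {f : ℕ → A} {s : A} (hf : SeriesTendsto f s) :
    SeriesTendsto (fun n => star (f n)) (star s) :=
  hf.map (starAddEquiv : A ≃+ A).toAddMonoidHom continuous_star

variable (A) in
/-- The space `H_A` of all sequences `(a_n)` in `A` such that `∑ a_n* a_n` converges in `A`. -/
def StdModule : Submodule ℂ (ℕ → A) where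
  carrier := {a | ∃ s, SeriesTendsto (fun n => star (a n) * a n) s}
  zero_mem' := ⟨0, by simp [SeriesTendsto]⟩
  add_mem' {a b} ha hb := by
    obtain ⟨s, hs⟩ := exists_inner_series ha hb
    obtain ⟨t, ht⟩ := exists_inner_series hb ha
    obtain ⟨u, hu⟩ := ha
    obtain ⟨v, hv⟩ := hb
    refine ⟨(u + t) + (s + v), ?_⟩
    convert (hu.add ht).add (hs.add hv) using 2 with n
    simp [add_mul, mul_add]
  smul_mem' c a := fun ⟨s, hs⟩ => ⟨star c • c • s, by
    convert (hs.const_smul c).const_smul (Star.star c) using 2 with n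
    exact (congrArg (· * c • a n) (star_smul c (a n))).trans
      ((smul_mul_assoc _ _ _).trans (congrArg _ (mul_smul_comm _ _ _)))⟩

/-- The right action `(a_n) b = (a_n b)` of `A` on `H_A`. -/
instance instSMulStdModule : SMul Aᵐᵒᵖ (StdModule A) where
  smul b a := ⟨fun n => a.1 n * b.unop, by
    obtain ⟨s, hs⟩ := a.2
    refine ⟨star b.unop * s * b.unop, ?_⟩
    convert (hs.const_mul (Star.star b.unop)).mul_const b.unop using 2 with n
    simp [mul_assoc]⟩

/-- The inner product `⟨(a_n), (b_n)⟩ = ∑ a_n* b_n` of `H_A`; the series always converges. -/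
noncomputable instance instInnerStdModule : Inner A (StdModule A) where
  inner a b := limUnder atTop fun N => ∑ n ∈ Finset.range N, star (a.1 n) * b.1 n

lemma StdModule.seriesTendsto_inner (a b : StdModule A) :
    SeriesTendsto (fun n => star (a.1 n) * b.1 n) (inner A a b) := by
  obtain ⟨s, hs⟩ := exists_inner_series a.2 b.2
  exact tendsto_nhds_limUnder ⟨s, hs⟩

lemma SeriesTendsto.inner_eq {a b : StdModule A} {s : A}
    (hs : SeriesTendsto (fun n => Star.star (a.1 n) * b.1 n) s) : inner A a b = s :=
  tendsto_nhds_unique (StdModule.seriesTendsto_inner a b) hs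

/-- `H_A` satisfies the algebraic laws of a module with Hermitian inner product. -/
instance instIsInnerModuleStdModule : IsInnerModule A (StdModule A) where
  add_rsmul x y a := Subtype.ext (funext fun n => add_mul (x.1 n) (y.1 n) a)
  rsmul_add x a b := Subtype.ext (funext fun n => mul_add (x.1 n) a b)
  rsmul_mul x a b := Subtype.ext (funext fun n => (mul_assoc (x.1 n) a b).symm)
  smul_rsmul c x a := Subtype.ext (funext fun n => smul_mul_assoc c (x.1 n) a)
  rsmul_smul c x a := Subtype.ext (funext fun n => mul_smul_comm c (x.1 n) a)
  inner_add x y z := by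
    refine SeriesTendsto.inner_eq ?_
    convert (StdModule.seriesTendsto_inner x y).add (StdModule.seriesTendsto_inner x z) using 2
      with n
    simp [mul_add]
  inner_smul c x y := by
    refine SeriesTendsto.inner_eq ?_
    convert (StdModule.seriesTendsto_inner x y).const_smul c using 2 with n
    exact mul_smul_comm c _ _
  inner_rsmul x y a := by
    refine SeriesTendsto.inner_eq ?_
    convert (StdModule.seriesTendsto_inner x y).mul_const a using 2 with n
    exact (mul_assoc _ _ _).symm
  star_inner x y := by
    refine (SeriesTendsto.inner_eq ?_).symm
    convert (StdModule.seriesTendsto_inner x y).star using 2 with n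
    simp

end StdModule

/-! ### Multipliers and frames -/

section Frames

variable {A E : Type*} [ProCStarAlgebra A] [AddCommGroup E] [Module ℂ E] [SMul Aᵐᵒᵖ E] [Inner A E]

/-- The multiplier module `M(E) = L(A, E)`. -/
abbrev Multiplier (A E : Type*) [ProCStarAlgebra A] [AddCommGroup E] [Module ℂ E]
    [SMul Aᵐᵒᵖ E] [Inner A E] :=
  Adjointable A A E

/-- The pairing `⟨h, x⟩ = h* (x) ∈ A` of a multiplier `h ∈ M(E)` with `x ∈ E`, that is, the inner
product of `h` and the image of `x` in `M(E)`. Its adjoint is `⟨x, h⟩ = (h* (x))*`. -/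
def Multiplier.pairing (h : Multiplier A E) (x : E) : A := h.adj x

/-- `E` is countably generated in `M(E)`: for some sequence `g n` of multipliers, the closed
submodule generated by the elements `g n · a = g n (a)` of `E`, for `a ∈ A`, is all of `E`.
(As `g n (a) b = g n (a b)`, the complex linear span of these elements is an `A`-submodule; `E` is
closed in `M(E)`, with the induced topology, so that the closure may be taken in `E`.) -/
def CountablyGeneratedInMultipliers (A E : Type*) [ProCStarAlgebra A] [AddCommGroup E]
    [Module ℂ E] [SMul Aᵐᵒᵖ E] [Inner A E] [TopologicalSpace E] : Prop :=
  ∃ g : ℕ → Multiplier A E,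
    closure (Submodule.span ℂ {x : E | ∃ (n : ℕ) (a : A), x = (g n).toFun a} : Set E) = Set.univ

/-- `h` is a standard frame of multipliers in `E`: the series `∑ ⟨x, h n⟩ ⟨h n, x⟩` converges in `A`
for every `x`, and its sum lies between `C ⟨x, x⟩` and `D ⟨x, x⟩` for some constants `C, D > 0`. -/
def IsStandardFrame [PartialOrder A] (h : ℕ → Multiplier A E) : Prop :=
  ∃ C D : ℝ, 0 < C ∧ 0 < D ∧ ∀ x : E, ∃ s : A,
    SeriesTendsto (fun n => star ((h n).pairing x) * (h n).pairing x) s ∧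
      (C : ℂ) • inner A x x ≤ s ∧ s ≤ (D : ℂ) • inner A x x

/-- The standard frame `t` is a dual frame of the standard frame `h`:
`x = ∑ h n · ⟨t n, x⟩` for all `x`. -/
def IsDualFrame [PartialOrder A] [TopologicalSpace E] (h t : ℕ → Multiplier A E) : Prop :=
  IsStandardFrame h ∧ IsStandardFrame t ∧
    ∀ x : E, SeriesTendsto (fun n => (h n).toFun ((t n).pairing x)) x

/-- `θ ∈ L(E, H_A)` is the frame transform `x ↦ (⟨h n, x⟩)ₙ` of `h`. -/
def IsFrameTransform (h : ℕ → Multiplier A E) (θ : Adjointable A E (StdModule A)) : Prop :=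
  ∀ (x : E) (n : ℕ), (θ.toFun x).1 n = (h n).pairing x

/-- `S` is the inverse of `T` in `L(E)`. -/
def IsInverse (S T : Adjointable A E E) : Prop :=
  S.comp T = Adjointable.id A E ∧ T.comp S = Adjointable.id A E

/-- `t` is the canonical dual of the standard frame `h`: the frame transform `θ` of `h` is
adjointable, `θ* ∘ θ` is invertible in `L(E)`, and `t n = (θ* ∘ θ)⁻¹ ∘ h n` for all `n`. -/
def IsCanonicalDual [PartialOrder A] [IsInnerModule A E] (h t : ℕ → Multiplier A E) : Prop :=
  IsStandardFrame h ∧ ∃ (θ : Adjointable A E (StdModule A)) (S : Adjointable A E E),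
    IsFrameTransform h θ ∧ IsInverse S (θ.adjoint.comp θ) ∧ ∀ n, t n = S.comp (h n)

end Frames

end ProCStar

namespace ProCStar

/-! ### Seminorms and convergence -/

section Seminorm

variable {A : Type*} [ProCStarAlgebra A]

/-! Write `T = θ*θ`. Since `⟨x, Tx⟩ = ⟨θx, θx⟩` is the frame sum at `x`, the frame condition says
that `T` is selfadjoint with `C ≤ T ≤ D` as quadratic forms. Such a `T` is invertible
(`Adjointable.exists_isInverse`): for `B = D + C` the operator `1 - B⁻¹T` contracts every seminorm
of `E` by the same factor `1 - C/B < 1`, so `Tx = y` is solved by fixed point iteration, although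
`E` carries no single norm.

Let `S = T⁻¹` and `t n = S ∘ h n`. As `S` is selfadjoint, `⟨t n, x⟩ = ⟨h n, Sx⟩`, so the frame
transform of `t` is `θS` and its frame operator is `STS = S`. Hence `S⁻¹ ∘ t n = T ∘ S ∘ h n = h n`,
and `∑ h n ⟨t n, x⟩ = θ*θSx = x`. The frame bounds of `t` are `D⁻¹ ≤ S ≤ C⁻¹`, obtained from
explicit sums of positive terms instead of a functional calculus in `L(E)`.

Two analytic facts carry this. `Adjointable.seminorm_inner_sq_le` is Cauchy-Schwarz for positive
forms, proved in the C*-completion of `A` for one seminorm; it gives the contraction estimate.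
`IsStandardFrame.exists_isFrameTransform` obtains `θ*` by showing that `∑ h n (a n)` converges for
every `a` in `H_A`. -/

lemma seminorm_real_smul (p : Seminorm ℂ A) {c : ℝ} (hc : 0 ≤ c) (a : A) :
    p ((c : ℂ) • a) = c * p a := by
  rw [map_smul_eq_mul, Complex.norm_real, Real.norm_of_nonneg hc]

lemma tendsto_iff_seminorm {ι : Type*} {l : Filter ι} {u : ι → A} {a : A} :
    Tendsto u l (𝓝 a) ↔ ∀ p : ContSeminorm A, Tendsto (fun i => p.1 (u i - a)) l (𝓝 0) := by
  have : Nonempty (ContSeminorm A) :=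
    ⟨⟨0, ⟨fun _ _ => by simp, fun _ => by simp⟩, continuous_const⟩⟩
  rw [ProCStarAlgebra.withSeminorms.tendsto_nhds]
  refine forall_congr' fun p => ?_
  rw [Metric.tendsto_nhds]
  simp only [Real.dist_0_eq_abs, abs_of_nonneg (apply_nonneg _ _)]

end Seminorm

section ModuleSeminorm

variable {A E : Type*} [ProCStarAlgebra A] [Inner A E]

lemma moduleSeminorm_nonneg (p : ContSeminorm A) (x : E) : 0 ≤ moduleSeminorm p x :=
  Real.sqrt_nonneg _

lemma moduleSeminorm_sq (p : ContSeminorm A) (x : E) :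
    moduleSeminorm p x ^ 2 = p.1 (inner A x x) := Real.sq_sqrt (apply_nonneg _ _)

end ModuleSeminorm

/-! ### Positivity in a pro-C*-algebra -/

section Order

variable {A : Type*} [ProCStarAlgebra A] [PartialOrder A] [StarOrderedRing A]

/-- The positive cone is additively generated by the elements `b* b`, and the factor `c` is absorbed
into `b` as `√c`. -/
lemma real_smul_nonneg {c : ℝ} (hc : 0 ≤ c) {a : A} (ha : 0 ≤ a) : 0 ≤ (c : ℂ) • a := by
  rw [StarOrderedRing.nonneg_iff] at ha
  induction ha using AddSubmonoid.closure_induction with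
  | mem x hx =>
    obtain ⟨b, rfl⟩ := hx
    have h : (c : ℂ) • (star b * b) = star ((√c : ℂ) • b) * ((√c : ℂ) • b) := by
      have h1 : star ((√c : ℂ) • b) = (√c : ℂ) • star b := by
        rw [star_smul, RCLike.star_def, Complex.conj_ofReal]
      rw [h1, smul_mul_assoc, mul_smul_comm, smul_smul, ← Complex.ofReal_mul,
        Real.mul_self_sqrt hc]
    rw [h]
    exact star_mul_self_nonneg _
  | zero => simp
  | add x y _ _ hx hy => rw [smul_add]; exact add_nonneg hx hy

/-- The *-homomorphism into the C*-completion for `p` preserves order, and the norm of a C*-algebra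
is monotone on positive elements. -/
lemma seminorm_mono {p : Seminorm ℂ A} (hp : IsCStarSeminorm p) {a b : A} (ha : 0 ≤ a)
    (hab : a ≤ b) : p a ≤ p b := by
  obtain ⟨B, iB, f, hf⟩ := exists_rep hp
  let iO : PartialOrder B := CStarAlgebra.spectralOrder B
  have iSO : StarOrderedRing B := CStarAlgebra.spectralOrderedRing B
  rw [← hf, ← hf]
  refine CStarAlgebra.norm_le_norm_of_nonneg_of_le ?_ (OrderHomClass.mono f hab)
  simpa using OrderHomClass.mono f ha

/-- A discriminant inequality: the abstract form of the Cauchy-Schwarz inequality. -/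
lemma seminorm_sq_le_of_forall_nonneg {p : Seminorm ℂ A} (hp : IsCStarSeminorm p) {a b c : A}
    (hb : 0 ≤ b) (h : ∀ t : ℝ, 0 ≤ star a * b * a - (t : ℂ) • (star a * a)
      - (t : ℂ) • (star a * a) + (t : ℂ) • ((t : ℂ) • c)) :
    p a ^ 2 ≤ p b * p c := by
  obtain ⟨B, iB, f, hf⟩ := exists_rep hp
  let iO : PartialOrder B := CStarAlgebra.spectralOrder B
  have iSO : StarOrderedRing B := CStarAlgebra.spectralOrderedRing B
  -- For `t > p b` one has `a* b a ≤ t a* a`, so the hypothesis at `t` leaves `t a* a ≤ t² c`.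
  -- Taking `t` strictly larger keeps it positive, so that it can be cancelled even if `p b = 0`;
  -- letting `t` decrease to `p b` finishes.
  have key : ∀ t : ℝ, p b < t → p a ^ 2 ≤ t * p c := fun t ht => by
    have ht0 : 0 < t := (apply_nonneg p b).trans_lt ht
    have h1 := OrderHomClass.mono f (h t)
    simp only [map_zero, map_add, map_sub, map_mul, map_star, map_smul] at h1
    have hb' : 0 ≤ f b := by simpa using OrderHomClass.mono f hb
    have h2 : star (f a) * f b * f a ≤ ‖f b‖ • (star (f a) * f a) :=
      CStarAlgebra.star_left_conjugate_le_norm_smul (IsSelfAdjoint.of_nonneg hb')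
    have h3 : ‖f b‖ • (star (f a) * f a) ≤ t • (star (f a) * f a) := by
      rw [hf]
      exact smul_le_smul_of_nonneg_right ht.le (star_mul_self_nonneg _)
    simp only [Complex.coe_smul] at h1
    have h4 : t • (star (f a) * f a) ≤ t • t • f c := by
      have h5 := h1.trans (add_le_add_left (sub_le_sub_right (sub_le_sub_right (h2.trans h3) _) _) _)
      simpa using h5
    have h6 := CStarAlgebra.norm_le_norm_of_nonneg_of_le
      (smul_nonneg ht0.le (star_mul_self_nonneg (f a))) h4
    rw [norm_smul, norm_smul, norm_smul, CStarRing.norm_star_mul_self, hf, hf,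
      Real.norm_of_nonneg ht0.le] at h6
    have := le_of_mul_le_mul_left h6 ht0
    rwa [← pow_two] at this
  have hlim : Tendsto (fun t : ℝ => t * p c) (𝓝[>] (p b)) (𝓝 (p b * p c)) :=
    ((continuous_id.mul continuous_const).tendsto (p b)).mono_left nhdsWithin_le_nhds
  exact ge_of_tendsto hlim (eventually_mem_nhdsWithin.mono fun t ht => key t ht)

/-- Finite sums are compared with later partial sums before passing to the limit in `ℝ`, so
closedness of the positive cone plays no role. -/
lemma SeriesTendsto.seminorm_sum_le {a : ℕ → A} {s : A} (ha : ∀ n, 0 ≤ a n)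
    (h : SeriesTendsto a s) (p : ContSeminorm A) (F : Finset ℕ) : p.1 (∑ n ∈ F, a n) ≤ p.1 s := by
  refine ge_of_tendsto ((p.2.2.tendsto s).comp h) ?_
  obtain ⟨M, hM⟩ := F.exists_nat_subset_range
  filter_upwards [eventually_ge_atTop M] with N hN
  refine seminorm_mono p.2.1 (Finset.sum_nonneg fun n _ => ha n) ?_
  exact Finset.sum_le_sum_of_subset_of_nonneg
    (hM.trans (Finset.range_mono hN)) fun n _ _ => ha n

end Order

/-! ### Algebra of the inner product -/

section InnerModule

variable {A E : Type*} [ProCStarAlgebra A] [AddCommGroup E] [Module ℂ E] [SMul Aᵐᵒᵖ E] [Inner A E]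
  [IsInnerModule A E]

lemma inner_add_left (x y z : E) : inner A (x + y) z = inner A x z + inner A y z := by
  rw [← IsInnerModule.star_inner, IsInnerModule.inner_add, star_add, IsInnerModule.star_inner,
    IsInnerModule.star_inner]

variable (A E) in
/-- The inner product as an additive map in each variable. -/
def innerAddHom : E →+ E →+ A :=
  AddMonoidHom.mk' (fun x => AddMonoidHom.mk' (fun y => inner A x y) (IsInnerModule.inner_add x))
    fun x y => AddMonoidHom.ext fun z => inner_add_left x y z

lemma inner_sub_right (x y z : E) : inner A x (y - z) = inner A x y - inner A x z :=
  map_sub (innerAddHom A E x) y z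

lemma inner_sub_left (x y z : E) : inner A (x - y) z = inner A x z - inner A y z :=
  DFunLike.congr_fun (map_sub (innerAddHom A E) x y) z

lemma inner_zero_right (x : E) : inner A x (0 : E) = 0 := map_zero (innerAddHom A E x)

lemma inner_zero_left (x : E) : inner A (0 : E) x = 0 :=
  DFunLike.congr_fun (map_zero (innerAddHom A E)) x

lemma inner_sum_right (x : E) (F : Finset ℕ) (u : ℕ → E) :
    inner A x (∑ n ∈ F, u n) = ∑ n ∈ F, inner A x (u n) := map_sum (innerAddHom A E x) u F

lemma inner_real_smul_left (c : ℝ) (x y : E) : inner A ((c : ℂ) • x) y = (c : ℂ) • inner A x y := by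
  rw [← IsInnerModule.star_inner, IsInnerModule.inner_smul, star_smul, IsInnerModule.star_inner,
    RCLike.star_def, Complex.conj_ofReal]

lemma inner_rsmul_left (x y : E) (a : A) :
    inner A (MulOpposite.op a • x) y = star a * inner A x y := by
  rw [← IsInnerModule.star_inner, IsInnerModule.inner_rsmul, star_mul, IsInnerModule.star_inner]

end InnerModule

/-! ### Cauchy-Schwarz and the topology of a Hilbert module -/

section HilbertModule

variable {A E : Type*} [ProCStarAlgebra A] [PartialOrder A] [StarOrderedRing A]
  [AddCommGroup E] [Module ℂ E] [SMul Aᵐᵒᵖ E] [Inner A E]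

/-- The Cauchy-Schwarz inequality for the form of a positive operator. -/
lemma Adjointable.seminorm_inner_sq_le [IsInnerModule A E] (T : Adjointable A E E)
    (hT : T.adj = T.toFun) (hpos : ∀ x, 0 ≤ inner A x (T.toFun x)) (p : ContSeminorm A) (x y : E) :
    p.1 (inner A x (T.toFun y)) ^ 2 ≤
      p.1 (inner A x (T.toFun x)) * p.1 (inner A y (T.toFun y)) := by
  refine seminorm_sq_le_of_forall_nonneg p.2.1 (hpos x) fun t => ?_
  set a := inner A x (T.toFun y) with ha
  have ha' : inner A y (T.toFun x) = star a := by
    rw [ha, IsInnerModule.star_inner, T.inner_toFun, hT]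
  -- The required expression is the form of `T` at the vector `x a - t y`, with `a = ⟨x, Ty⟩`.
  convert hpos (MulOpposite.op a • x - (t : ℂ) • y) using 1
  simp only [map_sub, map_smul, T.map_rsmul, inner_sub_left, inner_sub_right, inner_rsmul_left,
    inner_real_smul_left, IsInnerModule.inner_rsmul, IsInnerModule.inner_smul, ha', ← ha,
    sub_mul, smul_mul_assoc, mul_assoc, smul_sub]
  abel

variable [UniformSpace E] [IsHilbertModule A E]

lemma seminorm_inner_le (p : ContSeminorm A) (x y : E) :
    p.1 (inner A x y) ≤ moduleSeminorm p x * moduleSeminorm p y := by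
  have h := (Adjointable.id A E).seminorm_inner_sq_le rfl
    (fun x => IsHilbertModule.inner_self_nonneg x) p x y
  have h2 := Real.sqrt_le_sqrt h
  rwa [Real.sqrt_sq (apply_nonneg _ _), Real.sqrt_mul (apply_nonneg _ _)] at h2

lemma moduleSeminorm_add_le (p : ContSeminorm A) (x y : E) :
    moduleSeminorm p (x + y) ≤ moduleSeminorm p x + moduleSeminorm p y := by
  refine le_of_sq_le_sq ?_ (add_nonneg (moduleSeminorm_nonneg p x) (moduleSeminorm_nonneg p y))
  have h1 : p.1 (inner A (x + y) (x + y)) ≤ p.1 (inner A x x) + p.1 (inner A x y)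
      + (p.1 (inner A y x) + p.1 (inner A y y)) := by
    rw [inner_add_left, IsInnerModule.inner_add, IsInnerModule.inner_add]
    exact (map_add_le_add _ _ _).trans
      (add_le_add (map_add_le_add _ _ _) (map_add_le_add _ _ _))
  have h2 := seminorm_inner_le p x y
  have h3 := seminorm_inner_le p y x
  have h4 := moduleSeminorm_sq p x
  have h5 := moduleSeminorm_sq p y
  rw [moduleSeminorm_sq]
  nlinarith

lemma moduleSeminorm_zero (p : ContSeminorm A) : moduleSeminorm p (0 : E) = 0 := by
  rw [moduleSeminorm, inner_zero_right, map_zero, Real.sqrt_zero]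

lemma moduleSeminorm_neg (p : ContSeminorm A) (x : E) :
    moduleSeminorm p (-x) = moduleSeminorm p x := by
  have h : inner A (-x) (-x) = inner A x x := by
    rw [← zero_sub, inner_sub_left, inner_sub_right, inner_sub_right, inner_zero_right]
    simp [inner_zero_right, inner_zero_left]
  rw [moduleSeminorm, h]
  rfl

lemma moduleSeminorm_sub_rev (p : ContSeminorm A) (x y : E) :
    moduleSeminorm p (x - y) = moduleSeminorm p (y - x) := by
  rw [← neg_sub, moduleSeminorm_neg]

lemma ext_inner {x y : E} (h : ∀ z : E, inner A z x = inner A z y) : x = y := by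
  rw [← sub_eq_zero, ← IsHilbertModule.inner_self_eq_zero (A := A), inner_sub_right, h, sub_self]

variable (A) in
lemma tendsto_iff_moduleSeminorm {ι : Type*} {l : Filter ι} {u : ι → E} {x : E} :
    Tendsto u l (𝓝 x) ↔
      ∀ p : ContSeminorm A, Tendsto (fun i => moduleSeminorm p (u i - x)) l (𝓝 0) := by
  rw [nhds_eq_comap_uniformity, IsHilbertModule.uniformity_eq (A := A), tendsto_comap_iff,
    tendsto_iInf]
  refine forall_congr' fun p => ?_
  rw [tendsto_comap_iff]
  simp only [Function.comp_def, moduleSeminorm_sub_rev p x]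

variable (A) in
lemma exists_tendsto_of_moduleSeminorm {u : ℕ → E}
    (h : ∀ p : ContSeminorm A, ∀ ε > 0, ∃ N, ∀ m n, N ≤ m → m ≤ n →
      moduleSeminorm p (u n - u m) < ε) : ∃ x, Tendsto u atTop (𝓝 x) := by
  have := IsHilbertModule.complete A (E := E)
  refine cauchySeq_tendsto_of_complete ?_
  rw [cauchySeq_iff_tendsto, IsHilbertModule.uniformity_eq (A := A), tendsto_iInf]
  intro p
  rw [tendsto_comap_iff, Metric.tendsto_nhds]
  intro ε hε
  obtain ⟨N, hN⟩ := h p ε hε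
  filter_upwards [eventually_ge_atTop (N, N)] with ⟨m, n⟩ ⟨hm, hn⟩
  rw [Real.dist_0_eq_abs]
  change |moduleSeminorm p (u m - u n)| < ε
  rw [abs_of_nonneg (moduleSeminorm_nonneg p _)]
  rcases le_total m n with hmn | hmn
  · rw [moduleSeminorm_sub_rev]; exact hN m n hm hmn
  · exact hN n m hn hmn

lemma tendsto_inner_right {ι : Type*} {l : Filter ι} {u : ι → E} {x : E}
    (h : Tendsto u l (𝓝 x)) (z : E) :
    Tendsto (fun i => inner A z (u i)) l (𝓝 (inner A z x)) := by
  rw [tendsto_iff_seminorm]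
  rw [tendsto_iff_moduleSeminorm A] at h
  intro p
  have h1 := (h p).const_mul (moduleSeminorm p z)
  rw [mul_zero] at h1
  refine squeeze_zero (fun i => apply_nonneg _ _) (fun i => ?_) h1
  rw [← inner_sub_right]
  exact seminorm_inner_le p z _

end HilbertModule

end ProCStar

namespace ProCStar

/-- Hausdorffness of `E` is not part of its definition; limits are unique because `A` is Hausdorff
and the inner product is continuous and definite. -/
lemma IsHilbertModule.eq_of_tendsto (A : Type*) {E : Type*} [ProCStarAlgebra A] [PartialOrder A]
    [StarOrderedRing A] [AddCommGroup E] [Module ℂ E] [SMul Aᵐᵒᵖ E] [Inner A E] [UniformSpace E]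
    [IsHilbertModule A E] {u : ℕ → E} {x y : E} (hx : Tendsto u atTop (𝓝 x))
    (hy : Tendsto u atTop (𝓝 y)) : x = y :=
  ext_inner (A := A) fun z =>
    tendsto_nhds_unique (tendsto_inner_right hx z) (tendsto_inner_right hy z)

/-! ### Adjointable maps and fixed points of contractions -/

section AdjointableLemmas

variable {A E F : Type*} [ProCStarAlgebra A] [PartialOrder A] [StarOrderedRing A]
  [AddCommGroup E] [Module ℂ E] [SMul Aᵐᵒᵖ E] [Inner A E] [UniformSpace E] [IsHilbertModule A E]
  [AddCommGroup F] [Module ℂ F] [SMul Aᵐᵒᵖ F] [Inner A F]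

lemma Adjointable.inner_toFun_right [IsInnerModule A F] (T : Adjointable A F E) (x : F) (y : E) :
    inner A y (T.toFun x) = inner A (T.adj y) x := by
  rw [← IsInnerModule.star_inner, T.inner_toFun, IsInnerModule.star_inner]

/-- An adjointable operator is determined by its underlying map. -/
lemma Adjointable.ext_toFun {S T : Adjointable A E F} (h : ∀ x, S.toFun x = T.toFun x) : S = T := by
  refine Adjointable.ext (LinearMap.ext h) (LinearMap.ext fun y => ?_)
  refine ext_inner (A := A) fun x => ?_
  rw [← S.inner_toFun, ← T.inner_toFun, h]

/-- A pointwise adjoint of a module morphism is automatically a module morphism. -/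
lemma Adjointable.exists_of_inner_eq [IsInnerModule A F] (T : E →ₗ[ℂ] F)
    (hT : ∀ (x : E) (a : A), T (MulOpposite.op a • x) = MulOpposite.op a • T x) (g : F → E)
    (hg : ∀ x y, inner A (T x) y = inner A x (g y)) :
    ∃ S : Adjointable A E F, S.toFun = T ∧ ∀ y, S.adj y = g y :=
  ⟨{ toFun := T
     adj :=
      { toFun := g
        map_add' := fun y z => ext_inner (A := A) fun x => by
          rw [← hg, IsInnerModule.inner_add, IsInnerModule.inner_add, hg, hg]
        map_smul' := fun c y => ext_inner (A := A) fun x => by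
          rw [← hg, RingHom.id_apply, IsInnerModule.inner_smul, IsInnerModule.inner_smul, hg] }
     map_rsmul := hT
     adj_rsmul := fun y a => ext_inner (A := A) fun x => by
      change inner A x (g _) = inner A x (MulOpposite.op a • g y)
      rw [← hg, IsInnerModule.inner_rsmul, IsInnerModule.inner_rsmul, hg]
     inner_toFun := hg }, rfl, fun _ => rfl⟩

variable (A) in
/-- The equation `x = z + K x` has a solution when `K` is a strict contraction, uniformly for all
seminorms of the module. -/
lemma exists_eq_add_of_contraction (K : E →ₗ[ℂ] E) {r : ℝ} (hr0 : 0 ≤ r) (hr1 : r < 1)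
    (hK : ∀ (p : ContSeminorm A) (x : E), moduleSeminorm p (K x) ≤ r * moduleSeminorm p x) (z : E) :
    ∃ x, x = z + K x := by
  -- Fixed point iteration for `w ↦ z + K w` from `0`: the iterates are the partial sums of the
  -- Neumann series.
  let u : ℕ → E := fun n => Nat.rec 0 (fun _ w => z + K w) n
  have hu : ∀ n, u (n + 1) = z + K (u n) := fun n => rfl
  have h1r : 0 < 1 - r := sub_pos.mpr hr1
  have hbd : ∀ (p : ContSeminorm A) n, moduleSeminorm p (u n) ≤ moduleSeminorm p z / (1 - r) := by
    intro p n
    induction n with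
    | zero =>
      change moduleSeminorm p (0 : E) ≤ _
      rw [moduleSeminorm_zero]
      exact div_nonneg (moduleSeminorm_nonneg p z) h1r.le
    | succ n ih =>
      rw [hu]
      have h2 := (moduleSeminorm_add_le p z (K (u n))).trans
        (add_le_add_right ((hK p (u n)).trans (mul_le_mul_of_nonneg_left ih hr0)) _)
      refine h2.trans (le_of_eq ?_)
      field_simp
      ring
  -- With `j` fixed, each step in `m` applies `K` to the difference and gains a factor `r`; the case
  -- `m = 0` is the uniform bound `hbd`.
  have hdiff : ∀ (p : ContSeminorm A) m j,
      moduleSeminorm p (u (m + j) - u m) ≤ r ^ m * (moduleSeminorm p z / (1 - r)) := by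
    intro p m j
    induction m with
    | zero =>
      have h0 : u (0 + j) - u 0 = u j := by rw [zero_add]; exact sub_zero _
      rw [h0, pow_zero, one_mul]
      exact hbd p j
    | succ m ih =>
      have h3 : u (m + 1 + j) - u (m + 1) = K (u (m + j) - u m) := by
        rw [show m + 1 + j = (m + j) + 1 by ring, hu, hu, map_sub]
        abel
      rw [h3, pow_succ', mul_assoc]
      exact (hK p _).trans (mul_le_mul_of_nonneg_left ih hr0)
  obtain ⟨x, hx⟩ : ∃ x, Tendsto u atTop (𝓝 x) := by
    refine exists_tendsto_of_moduleSeminorm A fun p ε hε => ?_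
    have hlim := (tendsto_pow_atTop_nhds_zero_of_lt_one hr0 hr1).mul_const
      (moduleSeminorm p z / (1 - r))
    rw [zero_mul] at hlim
    obtain ⟨N, hN⟩ := eventually_atTop.mp (hlim.eventually_lt_const hε)
    refine ⟨N, fun m n hm hmn => ?_⟩
    obtain ⟨j, rfl⟩ := Nat.exists_eq_add_of_le hmn
    exact (hdiff p m j).trans_lt (hN m hm)
  -- The shifted sequence tends both to `x` and, by the contraction estimate, to `z + K x`.
  refine ⟨x, IsHilbertModule.eq_of_tendsto A ((tendsto_add_atTop_iff_nat 1).mpr hx) ?_⟩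
  rw [tendsto_iff_moduleSeminorm A] at hx ⊢
  intro p
  have h4 := (hx p).const_mul r
  rw [mul_zero] at h4
  refine squeeze_zero (fun n => moduleSeminorm_nonneg p _) (fun n => ?_) h4
  rw [hu, add_sub_add_left_eq_sub, ← map_sub]
  exact hK p _

end AdjointableLemmas

/-! ### Inverting an operator between two positive constants -/

section PositiveOperators

variable {A E : Type*} [ProCStarAlgebra A] [PartialOrder A] [StarOrderedRing A]
  [AddCommGroup E] [Module ℂ E] [SMul Aᵐᵒᵖ E] [Inner A E] [UniformSpace E] [IsHilbertModule A E]
  {T : Adjointable A E E} {C D : ℝ}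

/-- The operator `1 - D⁻¹ T`. -/
noncomputable def Adjointable.oneSubInvSMul (T : Adjointable A E E) (D : ℝ) : Adjointable A E E where
  toFun := LinearMap.id - ((D⁻¹ : ℝ) : ℂ) • T.toFun
  adj := LinearMap.id - ((D⁻¹ : ℝ) : ℂ) • T.adj
  map_rsmul x a := by
    simp only [LinearMap.sub_apply, LinearMap.smul_apply, LinearMap.id_apply, T.map_rsmul]
    refine ext_inner (A := A) fun z => ?_
    simp only [inner_sub_right, IsInnerModule.inner_smul, IsInnerModule.inner_rsmul, sub_mul,
      smul_mul_assoc]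
  adj_rsmul x a := by
    simp only [LinearMap.sub_apply, LinearMap.smul_apply, LinearMap.id_apply, T.adj_rsmul]
    refine ext_inner (A := A) fun z => ?_
    simp only [inner_sub_right, IsInnerModule.inner_smul, IsInnerModule.inner_rsmul, sub_mul,
      smul_mul_assoc]
  inner_toFun x y := by
    simp only [LinearMap.sub_apply, LinearMap.smul_apply, LinearMap.id_apply, inner_sub_left,
      inner_sub_right, inner_real_smul_left, IsInnerModule.inner_smul, T.inner_toFun]

/-- With `r = 1 - C/D`, the form of `K = 1 - D⁻¹T` lies between `0` and `r ⟨x, x⟩`. Cauchy-Schwarz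
for this form at the pair `(Kx, x)` bounds `|Kx|⁴` by `r|Kx|² · r|x|²`, and `|Kx|²` cancels unless
it vanishes. -/
lemma Adjointable.moduleSeminorm_oneSubInvSMul_le (hT : T.adj = T.toFun) (hD : 0 < D)
    (hCD : C ≤ D) (hlow : ∀ x, (C : ℂ) • inner A x x ≤ inner A x (T.toFun x))
    (hupp : ∀ x, inner A x (T.toFun x) ≤ (D : ℂ) • inner A x x) (p : ContSeminorm A) (x : E) :
    moduleSeminorm p ((T.oneSubInvSMul D).toFun x) ≤ (1 - D⁻¹ * C) * moduleSeminorm p x := by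
  set K := T.oneSubInvSMul D with hKdef
  have hr : 0 ≤ 1 - D⁻¹ * C := by
    rw [sub_nonneg, inv_mul_le_iff₀ hD, mul_one]
    exact hCD
  have hDc : (D : ℂ) ≠ 0 := Complex.ofReal_ne_zero.mpr hD.ne'
  have hKinner : ∀ x, inner A x (K.toFun x)
      = inner A x x - ((D⁻¹ : ℝ) : ℂ) • inner A x (T.toFun x) := fun x => by
    simp only [hKdef, Adjointable.oneSubInvSMul, LinearMap.sub_apply, LinearMap.smul_apply,
      LinearMap.id_apply, inner_sub_right, IsInnerModule.inner_smul]
  have hKpos : ∀ x, 0 ≤ inner A x (K.toFun x) := fun x => by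
    have h := real_smul_nonneg (inv_nonneg.mpr hD.le) (sub_nonneg.mpr (hupp x))
    rw [hKinner]
    convert h using 1
    rw [smul_sub, smul_smul, Complex.ofReal_inv, inv_mul_cancel₀ hDc, one_smul]
  have hKle : ∀ x, p.1 (inner A x (K.toFun x)) ≤ (1 - D⁻¹ * C) * moduleSeminorm p x ^ 2 := by
    intro x
    rw [moduleSeminorm_sq, ← seminorm_real_smul _ hr]
    refine seminorm_mono p.2.1 (hKpos x) ?_
    have h := real_smul_nonneg (inv_nonneg.mpr hD.le) (sub_nonneg.mpr (hlow x))
    rw [hKinner, ← sub_nonneg]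
    convert h using 1
    push_cast
    module
  have hcs := K.seminorm_inner_sq_le (by simp only [hKdef, Adjointable.oneSubInvSMul, hT]) hKpos p
    (K.toFun x) x
  rw [← moduleSeminorm_sq] at hcs
  have h1 := hcs.trans (mul_le_mul (hKle _) (hKle _) (apply_nonneg _ _)
    (mul_nonneg hr (sq_nonneg _)))
  have hk := moduleSeminorm_nonneg p (K.toFun x)
  have hx := moduleSeminorm_nonneg p x
  rcases hk.eq_or_lt with h0 | h0
  · rw [← h0]; exact mul_nonneg hr hx
  · refine le_of_sq_le_sq ?_ (mul_nonneg hr hx)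
    refine le_of_mul_le_mul_left ?_ (pow_pos h0 2)
    nlinarith

/-- A selfadjoint operator bounded below by a positive constant is invertible. -/
lemma Adjointable.exists_isInverse (hT : T.adj = T.toFun) (hC : 0 < C) (hD : 0 < D)
    (hlow : ∀ x, (C : ℂ) • inner A x x ≤ inner A x (T.toFun x))
    (hupp : ∀ x, inner A x (T.toFun x) ≤ (D : ℂ) • inner A x x) :
    ∃ S : Adjointable A E E, IsInverse S T ∧ S.adj = S.toFun := by
  -- The upper bound is enlarged to `D + C`, so that it dominates `C` without assuming `C ≤ D`,
  -- which can fail in the zero module. The contraction factor `1 - C/(D + C)` then lies in `[0,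
  -- 1)`.
  have hB : 0 < D + C := add_pos hD hC
  have hBc : ((D + C : ℝ) : ℂ) ≠ 0 := Complex.ofReal_ne_zero.mpr hB.ne'
  have hupp' : ∀ x, inner A x (T.toFun x) ≤ ((D + C : ℝ) : ℂ) • inner A x x := fun x => by
    rw [Complex.ofReal_add, add_smul]
    exact (hupp x).trans
      (le_add_of_nonneg_right (real_smul_nonneg hC.le (IsHilbertModule.inner_self_nonneg x)))
  have hr0 : 0 ≤ 1 - (D + C)⁻¹ * C := by
    rw [sub_nonneg, inv_mul_le_iff₀ hB]
    linarith
  have hr1 : 1 - (D + C)⁻¹ * C < 1 := sub_lt_self _ (mul_pos (inv_pos.mpr hB) hC)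
  have hbij : Function.Bijective T.toFun := by
    constructor
    · rw [injective_iff_map_eq_zero]
      intro x hx
      have h1 := real_smul_nonneg (inv_nonneg.mpr hC.le) (sub_nonneg.mpr (hlow x))
      rw [hx, inner_zero_right, zero_sub, smul_neg, smul_smul, Complex.ofReal_inv,
        inv_mul_cancel₀ (Complex.ofReal_ne_zero.mpr hC.ne'), one_smul] at h1
      exact (IsHilbertModule.inner_self_eq_zero (A := A) x).mp
        (le_antisymm (neg_nonneg.mp h1) (IsHilbertModule.inner_self_nonneg x))
    · intro y
      -- For `K = 1 - B⁻¹T` and `B = D + C`, the equation `x = B⁻¹y + Kx` amounts to `Tx = y`.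
      obtain ⟨x, hx⟩ := exists_eq_add_of_contraction A (T.oneSubInvSMul (D + C)).toFun hr0 hr1
        (fun p x => T.moduleSeminorm_oneSubInvSMul_le hT hB (by linarith) hlow hupp' p x)
        ((((D + C)⁻¹ : ℝ) : ℂ) • y)
      refine ⟨x, ?_⟩
      simp only [Adjointable.oneSubInvSMul, LinearMap.sub_apply, LinearMap.smul_apply,
        LinearMap.id_apply] at hx
      have h2 : (((D + C)⁻¹ : ℝ) : ℂ) • y = (((D + C)⁻¹ : ℝ) : ℂ) • T.toFun x := by
        rw [← sub_eq_zero, ← sub_eq_zero.mpr hx.symm]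
        abel
      rw [Complex.ofReal_inv] at h2
      exact (smul_right_injective E (inv_ne_zero hBc) h2).symm
  let e := LinearEquiv.ofBijective T.toFun hbij
  have he : ∀ x, T.toFun (e.symm x) = x := e.apply_symm_apply
  have he' : ∀ x, e.symm (T.toFun x) = x := e.symm_apply_apply
  have hlin : ∀ (x : E) (a : A), e.symm (MulOpposite.op a • x) = MulOpposite.op a • e.symm x :=
    fun x a => hbij.1 (by rw [T.map_rsmul, he, he])
  refine ⟨⟨e.symm.toLinearMap, e.symm.toLinearMap, hlin, hlin, fun x y => ?_⟩,
    ⟨Adjointable.ext_toFun he', Adjointable.ext_toFun he⟩, rfl⟩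
  change inner A (e.symm x) y = inner A x (e.symm y)
  -- Both sides become forms of `T` at `T⁻¹x` and `T⁻¹y`, which agree since `T` is selfadjoint.
  conv_lhs => rw [← he y]
  conv_rhs => rw [← he x]
  rw [T.inner_toFun, hT]

/-- This is `T² ≤ D T`; at `y = T⁻¹x` it becomes `D⁻¹ ≤ T⁻¹`. The difference of the two sides is
`D⁻²` times the sum of `D⟨Ty, Ty⟩ - ⟨Ty, T(Ty)⟩` and the form of `T` at `Dy - Ty`, both positive. -/
lemma Adjointable.inv_smul_inner_toFun_le (hT : T.adj = T.toFun) (hD : 0 < D)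
    (hpos : ∀ x, 0 ≤ inner A x (T.toFun x))
    (hupp : ∀ x, inner A x (T.toFun x) ≤ (D : ℂ) • inner A x x) (y : E) :
    ((D⁻¹ : ℝ) : ℂ) • inner A (T.toFun y) (T.toFun y) ≤ inner A y (T.toFun y) := by
  have hDc : (D : ℂ) ≠ 0 := Complex.ofReal_ne_zero.mpr hD.ne'
  have h1 := sub_nonneg.mpr (hupp (T.toFun y))
  have h2 := hpos ((D : ℂ) • y - T.toFun y)
  have h3 := real_smul_nonneg (pow_nonneg (inv_nonneg.mpr hD.le) 2) (add_nonneg h1 h2)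
  have h4 : inner A y (T.toFun (T.toFun y)) = inner A (T.toFun y) (T.toFun y) := by
    rw [T.inner_toFun, hT]
  rw [← sub_nonneg]
  convert h3 using 1
  simp only [map_sub, map_smul, inner_sub_left, inner_sub_right, inner_real_smul_left,
    IsInnerModule.inner_smul, h4]
  match_scalars
  · field_simp
  · field_simp
    ring
  · ring

/-- This is `C T ≤ T²`; at `y = T⁻¹x` it becomes `T⁻¹ ≤ C⁻¹`. The difference of the two sides is
`C⁻¹` times the sum of `C(⟨y, Ty⟩ - C⟨y, y⟩)` and `⟨Ty - Cy, Ty - Cy⟩`. -/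
lemma Adjointable.inner_le_inv_smul_inner_toFun (hT : T.adj = T.toFun) (hC : 0 < C)
    (hlow : ∀ x, (C : ℂ) • inner A x x ≤ inner A x (T.toFun x)) (y : E) :
    inner A y (T.toFun y) ≤ ((C⁻¹ : ℝ) : ℂ) • inner A (T.toFun y) (T.toFun y) := by
  have hCc : (C : ℂ) ≠ 0 := Complex.ofReal_ne_zero.mpr hC.ne'
  have h1 := real_smul_nonneg hC.le (sub_nonneg.mpr (hlow y))
  have h2 := IsHilbertModule.inner_self_nonneg (A := A) (T.toFun y - (C : ℂ) • y)
  have h3 := real_smul_nonneg (inv_nonneg.mpr hC.le) (add_nonneg h1 h2)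
  have h4 : inner A (T.toFun y) y = inner A y (T.toFun y) := by rw [T.inner_toFun, hT]
  rw [← sub_nonneg]
  convert h3 using 1
  simp only [inner_sub_left, inner_sub_right, inner_real_smul_left,
    IsInnerModule.inner_smul, h4]
  match_scalars
  · ring
  · field_simp
    ring
  · ring

end PositiveOperators

/-! ### Frame transforms and canonical duals -/

section Frames

variable {A E : Type*} [ProCStarAlgebra A] [PartialOrder A] [StarOrderedRing A]
  [AddCommGroup E] [Module ℂ E] [SMul Aᵐᵒᵖ E] [Inner A E] [UniformSpace E] [IsHilbertModule A E]

/-- The frame transform of a standard frame is adjointable, with adjoint `(aₙ) ↦ ∑ h n (aₙ)`. -/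
lemma IsStandardFrame.exists_isFrameTransform {h : ℕ → Multiplier A E} (hh : IsStandardFrame h) :
    ∃ θ : Adjointable A E (StdModule A), IsFrameTransform h θ ∧
      ∀ a : StdModule A, SeriesTendsto (fun n => (h n).toFun (a.1 n)) (θ.adj a) := by
  obtain ⟨C, D, hC, hD, hCD⟩ := hh
  have hbessel : ∀ (p : ContSeminorm A) (F : Finset ℕ) (x : E),
      p.1 (∑ n ∈ F, star ((h n).adj x) * (h n).adj x) ≤ D * p.1 (inner A x x) := by
    intro p F x
    obtain ⟨s, hs, hs1, hs2⟩ := hCD x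
    refine (hs.seminorm_sum_le (fun n => star_mul_self_nonneg _) p F).trans ?_
    rw [← seminorm_real_smul _ hD.le]
    exact seminorm_mono p.2.1 ((real_smul_nonneg hC.le
      (IsHilbertModule.inner_self_nonneg x)).trans hs1) hs2
  have hinner : ∀ (x : E) (F : Finset ℕ) (a : ℕ → A),
      inner A x (∑ n ∈ F, (h n).toFun (a n)) = ∑ n ∈ F, star ((h n).adj x) * a n := by
    intro x F a
    rw [inner_sum_right]
    exact Finset.sum_congr rfl fun n _ => (h n).inner_toFun_right (a n) x
  have hconv : ∀ a : StdModule A, ∃ y, SeriesTendsto (fun n => (h n).toFun (a.1 n)) y := by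
    intro a
    refine exists_tendsto_of_moduleSeminorm A fun p ε hε => ?_
    -- A block `v` of the series is tested against itself: `⟨v, v⟩ = ∑ ⟨v, h k⟩ a k`, and
    -- Cauchy-Schwarz with the Bessel bound gives `|v|² ≤ D p(∑ a k* a k)` over the block. Blocks of
    -- `∑ a k* a k` below `ε²/D` therefore force `|v| < ε`.
    obtain ⟨N, hN⟩ := (exists_seriesTendsto_iff _).mp a.2 p (ε ^ 2 / D) (by positivity)
    refine ⟨N, fun m n hm hmn => ?_⟩
    rw [← Finset.sum_Ico_eq_sub _ hmn]
    set v := ∑ k ∈ Finset.Ico m n, (h k).toFun (a.1 k) with hv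
    have h1 : moduleSeminorm p v ^ 2 ≤ √(D * moduleSeminorm p v ^ 2) *
        √(p.1 (∑ k ∈ Finset.Ico m n, star (a.1 k) * a.1 k)) := by
      have h0 : inner A v v = ∑ k ∈ Finset.Ico m n, star ((h k).adj v) * a.1 k := hinner v _ _
      rw [moduleSeminorm_sq]
      conv_lhs => rw [h0]
      exact (seminorm_sum_star_mul_le p.2.1 _ (fun k => (h k).adj v) _).trans
        (mul_le_mul_of_nonneg_right (Real.sqrt_le_sqrt (hbessel p _ v)) (Real.sqrt_nonneg _))
    have h2 := hN m n hm hmn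
    by_contra! hcon
    have hv0 : 0 < moduleSeminorm p v := hε.trans_le hcon
    rw [← Real.sqrt_mul (by positivity)] at h1
    have h3 := (Real.le_sqrt (by positivity) (mul_nonneg (by positivity) (apply_nonneg _ _))).mp h1
    have h4 : moduleSeminorm p v ^ 2 * moduleSeminorm p v ^ 2 <
        moduleSeminorm p v ^ 2 * ε ^ 2 := by
      calc moduleSeminorm p v ^ 2 * moduleSeminorm p v ^ 2
          = (moduleSeminorm p v ^ 2) ^ 2 := by ring
        _ ≤ _ := h3
        _ < D * moduleSeminorm p v ^ 2 * (ε ^ 2 / D) :=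
          mul_lt_mul_of_pos_left h2 (by positivity)
        _ = _ := by field_simp
    have h5 := lt_of_mul_lt_mul_left h4 (by positivity)
    exact absurd (pow_le_pow_left₀ hε.le hcon 2) (not_le.mpr h5)
  choose g hg using hconv
  let T : E →ₗ[ℂ] StdModule A :=
    { toFun := fun x => ⟨fun n => (h n).adj x, let ⟨s, hs, _⟩ := hCD x; ⟨s, hs⟩⟩
      map_add' := fun x y => Subtype.ext (funext fun n => map_add (h n).adj x y)
      map_smul' := fun c x => Subtype.ext (funext fun n => map_smul (h n).adj c x) }
  obtain ⟨θ, hθ, hθ'⟩ := Adjointable.exists_of_inner_eq (A := A) T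
    (fun x a => Subtype.ext (funext fun n => (h n).adj_rsmul x a)) g fun x a => by
      refine tendsto_nhds_unique (StdModule.seriesTendsto_inner (T x) a) ?_
      refine (tendsto_inner_right (hg a) x).congr fun N => ?_
      rw [hinner]
      rfl
  refine ⟨θ, fun x n => by rw [hθ]; rfl, fun a => by rw [hθ']; exact hg a⟩

/-- This turns the frame inequalities into operator bounds for `θ*θ`, through `⟨θx, θx⟩ = ⟨x,
θ*θx⟩`. -/
lemma IsFrameTransform.seriesTendsto {h : ℕ → Multiplier A E}
    {θ : Adjointable A E (StdModule A)} (hθ : IsFrameTransform h θ) (x : E) :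
    SeriesTendsto (fun n => star ((h n).pairing x) * (h n).pairing x)
      (inner A x ((θ.adjoint.comp θ).toFun x)) := by
  have h1 := StdModule.seriesTendsto_inner (θ.toFun x) (θ.toFun x)
  simp only [hθ x] at h1
  rwa [θ.inner_toFun] at h1

/-- A sequence of multipliers has at most one canonical dual. -/
lemma IsCanonicalDual.unique {h t t' : ℕ → Multiplier A E} (ht : IsCanonicalDual h t)
    (ht' : IsCanonicalDual h t') : t' = t := by
  obtain ⟨-, θ, S, hθ, hS, ht⟩ := ht
  obtain ⟨-, θ', S', hθ', hS', ht'⟩ := ht'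
  have h1 : θ' = θ := Adjointable.ext_toFun fun x =>
    Subtype.ext (funext fun n => by rw [hθ', hθ])
  subst h1
  -- With `T = θ*θ`, a left inverse equals a right inverse: `S'x = S'(T(Sx)) = Sx`.
  have h2 : S' = S := Adjointable.ext_toFun fun x => by
    have h3 := congrArg (fun R : Adjointable A E E => R.toFun x) hS.2
    have h4 := congrArg (fun R : Adjointable A E E => R.toFun (S.toFun x)) hS'.1
    exact (congrArg S'.toFun h3).symm.trans h4
  funext n
  rw [ht, ht', h2]

end Frames

end ProCStar

/-! ### The canonical dual and its own canonical dual -/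

open ProCStar in
theorem corollary4p7 {A E : Type*} [ProCStar.ProCStarAlgebra A] [PartialOrder A]
    [StarOrderedRing A] [AddCommGroup E] [Module ℂ E] [SMul Aᵐᵒᵖ E] [Inner A E] [UniformSpace E]
    [ProCStar.IsHilbertModule A E]
    (hE : ProCStar.CountablyGeneratedInMultipliers A E)
    (h : ℕ → ProCStar.Multiplier A E) (hh : ProCStar.IsStandardFrame h) :
    ∃ t : ℕ → ProCStar.Multiplier A E,
      (∀ t', ProCStar.IsCanonicalDual h t' ↔ t' = t) ∧
      ProCStar.IsDualFrame h t ∧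
      (∀ u, ProCStar.IsCanonicalDual t u ↔ u = h) := by
  obtain ⟨θ, hθ, hsum⟩ := hh.exists_isFrameTransform
  obtain ⟨C, D, hC, hD, hCD⟩ := id hh
  set T := θ.adjoint.comp θ with hTdef
  have hT : T.adj = T.toFun := rfl
  have hs : ∀ x, (C : ℂ) • inner A x x ≤ inner A x (T.toFun x) ∧
      inner A x (T.toFun x) ≤ (D : ℂ) • inner A x x := fun x => by
    obtain ⟨s, hs, hs'⟩ := hCD x
    rwa [tendsto_nhds_unique (hθ.seriesTendsto x) hs]
  have hlow := fun x => (hs x).1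
  have hupp := fun x => (hs x).2
  have hpos : ∀ x, 0 ≤ inner A x (T.toFun x) := fun x =>
    (real_smul_nonneg hC.le (IsHilbertModule.inner_self_nonneg x)).trans (hlow x)
  obtain ⟨S, hS, hS'⟩ := Adjointable.exists_isInverse hT hC hD hlow hupp
  have hTS : ∀ x, T.toFun (S.toFun x) = x := fun x =>
    congrArg (fun R : Adjointable A E E => R.toFun x) hS.2
  have hST : ∀ x, S.toFun (T.toFun x) = x := fun x =>
    congrArg (fun R : Adjointable A E E => R.toFun x) hS.1
  have hpair : ∀ x n, Multiplier.pairing (S.comp (h n)) x = (h n).pairing (S.toFun x) :=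
    fun x n => by rw [← hS']; rfl
  have ht : IsStandardFrame fun n => S.comp (h n) := by
    -- The frame sum of `t` at `x` is that of `h` at `Sx`, namely `⟨Sx, T(Sx)⟩ = ⟨Sx, x⟩`; the two
    -- inequalities for `T` at `y = Sx` bound it.
    refine ⟨D⁻¹, C⁻¹, inv_pos.mpr hD, inv_pos.mpr hC, fun x => ?_⟩
    have h1 := Adjointable.inv_smul_inner_toFun_le hT hD hpos hupp (S.toFun x)
    have h2 := Adjointable.inner_le_inv_smul_inner_toFun hT hC hlow (S.toFun x)
    have h3 := hθ.seriesTendsto (S.toFun x)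
    rw [← hTdef] at h3
    simp only [hTS] at h1 h2 h3
    exact ⟨_, by simpa only [hpair] using h3, h1, h2⟩
  have hcan : IsCanonicalDual h fun n => S.comp (h n) := ⟨hh, θ, S, hθ, hS, fun _ => rfl⟩
  have hcan' : IsCanonicalDual (fun n => S.comp (h n)) h := by
    -- The frame operator of `t` is `S*θ*θS = STS = S`, whose inverse is `T`.
    have hθS : (θ.comp S).adjoint.comp (θ.comp S) = S := Adjointable.ext_toFun fun x => by
      change S.adj (T.toFun (S.toFun x)) = S.toFun x
      rw [hTS, hS']
    refine ⟨ht, θ.comp S, T, fun x n => ?_, ?_, fun n => ?_⟩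
    · rw [hpair]
      exact hθ _ n
    · rw [hθS]
      exact ⟨hS.2, hS.1⟩
    · exact Adjointable.ext (LinearMap.ext fun a => (hTS _).symm)
        (LinearMap.ext fun x => by
          change (h n).adj x = (h n).adj (S.adj (T.adj x))
          rw [hS', hT, hST])
  refine ⟨fun n => S.comp (h n), fun t' => ⟨fun h' => hcan.unique h', fun h' => h' ▸ hcan⟩,
    ⟨hh, ht, fun x => ?_⟩, fun u => ⟨fun h' => hcan'.unique h', fun h' => h' ▸ hcan'⟩⟩
  -- The series formula for `θ*` at the sequence `θSx = (⟨t n, x⟩)ₙ` has sum `θ*θSx = TSx = x`.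
  have h1 := hsum (θ.toFun (S.toFun x))
  simp only [hθ (S.toFun x)] at h1
  simp only [hpair]
  convert h1 using 1
  exact (hTS x).symm
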